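/- Call a (not necessarily continuous) function $s:(0,\infty)\to(0,\infty)$ asymptotically subpower if for every $\alpha>0$ there is $t_0>0$ such that $s(t)<t^{\alpha}$ for all $t>t_0$. Let $X=[0,\infty)$ carry the usual metric $d(x,y)=|x-y|$, with base point $0$, so that $|x|=d(0,x)=x$. Let $C_P(X)$ be the set of all bounded continuous functions $f:X\to\mathbb R$ such that for every asymptotically subpower function $s$ $$\lim_{|x|\to\infty}\operatorname{diam} f\bigl(B_d(x,s(|x|))\bigr)=0 ,$$ where $B_d(x,r)=\{y\in X: d(x,y)\le r\}$. Let $$e:X\to\prod_{f\in C_P(X)}[\inf f,\sup f],\qquad (e(x))_f=f(x),$$ be the evaluation map into the product space. The subpower Higson compactification $h_PX$ is the closure of $e(X)$ in this product, where $X$ is identified with $e(X)$, and the subpower Higson corona of $X$ is the subspace $\nu_PX=h_PX\setminus X=\overline{e(X)}\setminus e(X)$. A continuum is a nonempty compact connected Hausdorff space. A continuum is decomposable if it is the union of two proper subsets each of which is a continuum in the subspace topology, and indecomposable otherwise. **Theorem.** The subpower Higson corona $\nu_PX$ of $X=[0,\infty)$ is a continuum, it is not metrizable, and it is indecomposable.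 -/

import Mathlib

open Filter Topology Set
open scoped NNReal BoundedContinuousFunction

noncomputable section

namespace SubpowerHigson

/-- A (not necessarily continuous) function `s` from the positive reals to the positive reals is
asymptotically subpower if for every `α > 0` one has `s t < t ^ α` for all large `t`. The function
is given on all of `ℝ`; its values outside `(0, ∞)` are irrelevant. -/
def AsymptoticallySubpower (s : ℝ → ℝ) : Prop :=
  (∀ t : ℝ, 0 < t → 0 < s t) ∧
    ∀ α : ℝ, 0 < α → ∃ t₀ : ℝ, 0 < t₀ ∧ ∀ t : ℝ, t₀ < t → s t < t ^ α

/-- A bounded continuous real function `f` on a metric space with base point `x₀` is Higson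
subpower if, for every asymptotically subpower `s`, the diameter of the image under `f` of the
ball of radius `s |x|` around `x` tends to `0` as `|x| = dist x₀ x` tends to infinity. As `f` is
bounded, `Metric.diam` is the true diameter here. -/
def HigsonSubpower {X : Type*} [MetricSpace X] (x₀ : X) (f : X →ᵇ ℝ) : Prop :=
  ∀ s : ℝ → ℝ, AsymptoticallySubpower s →
    Tendsto (fun x : X => Metric.diam (f '' Metric.closedBall x (s (dist x₀ x))))
      (comap (fun x : X => dist x₀ x) atTop) (𝓝 0)

/-- `C_P(X)`: the set of all bounded continuous real functions that are Higson subpower. -/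
def subpowerFunctions {X : Type*} [MetricSpace X] (x₀ : X) : Set (X →ᵇ ℝ) :=
  {f | HigsonSubpower x₀ f}

/-- The interval `I_f = [inf f, sup f]`. -/
abbrev valueInterval {X : Type*} [TopologicalSpace X] (f : X →ᵇ ℝ) : Set ℝ :=
  Icc (⨅ x, f x) (⨆ x, f x)

theorem apply_mem_valueInterval {X : Type*} [TopologicalSpace X] (f : X →ᵇ ℝ) (x : X) :
    f x ∈ valueInterval f :=
  ⟨ciInf_le f.isBounded_range.bddBelow x, le_ciSup f.isBounded_range.bddAbove x⟩

/-- The evaluation map `e_F : X → ∏_{f ∈ F} I_f`, `(e_F x)_f = f x`. -/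
def evalMap {X : Type*} [TopologicalSpace X] (F : Set (X →ᵇ ℝ)) (x : X) :
    ∀ f : F, valueInterval f.1 :=
  fun f => ⟨f.1 x, apply_mem_valueInterval f.1 x⟩

/-- The subpower Higson compactification `h_P X`: the closure of `e_F(X)` in `∏_{f ∈ F} I_f` for
`F = C_P(X)`, with `X` identified with `e_F(X)`. -/
def compactification {X : Type*} [MetricSpace X] (x₀ : X) :
    Set (∀ f : subpowerFunctions x₀, valueInterval f.1) :=
  closure (range (evalMap (subpowerFunctions x₀)))

/-- The subpower Higson corona `ν_P X = h_P X \ X`; as a topological space it carries the subspace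
topology from the product. -/
def corona {X : Type*} [MetricSpace X] (x₀ : X) :
    Set (∀ f : subpowerFunctions x₀, valueInterval f.1) :=
  compactification x₀ \ range (evalMap (subpowerFunctions x₀))

/-- A continuum is a nonempty, compact and connected Hausdorff space. -/
def IsContinuum (S : Type*) [TopologicalSpace S] : Prop :=
  Nonempty S ∧ CompactSpace S ∧ ConnectedSpace S ∧ T2Space S

/-- A space is decomposable if it is the union of two proper subsets that are continua. -/
def IsDecomposable (S : Type*) [TopologicalSpace S] : Prop :=
  ∃ A B : Set S, IsContinuum A ∧ IsContinuum B ∧ A ≠ univ ∧ B ≠ univ ∧ A ∪ B = univ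

end SubpowerHigson

end

/-!
A bounded function on the half-line lies in `C_P` only if, for every `ε > 0`, some exponent `α > 0`
makes its oscillation on the balls of radius `x ^ α` less than `ε` for all large `x`
(`HigsonSubpower.exists_rpow`). Conversely, slopes of order `x ^ (-α)` are enough
(`higsonSubpower_of_dist_le`). The second fact gives a Urysohn lemma, `exists_subpower_separation`:
two sets whose mutual distance grows like a power of `x` are separated by a function in `C_P`.

The corona is the decreasing intersection of the closures of the images of the rays `[n, ∞)`, which
are compact and connected; so it is a continuum (`isContinuum_corona`).

Were it metrizable, a sequence in the half-line could be chosen which converges to a point of the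
corona and grows exponentially. A function in `C_P` can then be made to alternate between `0` and
`1` along the sequence, which is absurd (`not_metrizableSpace_corona`).

Were it the union of proper subcontinua `A` and `B`, there would be a point `p ∉ B` and a point
`q ∉ A`. The half-line comes back infinitely often near `p` and near `q`. Each far visit near `q`
spends a whole interval around `b`, of length of order `b ^ α`, away from `A`, and this is room
enough for a function in `C_P` to pass between `0` and `1`. So there is a function in `C_P` whose
extension to the corona takes only the values `0` and `1` on `A`, and takes both near `p`;
hence `A` is disconnected (`not_isPreconnected_of_union_eq`).
-/

namespace SubpowerHigson

/-! ### Functions in `C_P` -/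

theorem dist_zero_coe (x : ℝ≥0) : dist (0 : ℝ≥0) x = (x : ℝ) := by
  rw [NNReal.dist_eq, NNReal.coe_zero, zero_sub, abs_neg, NNReal.abs_eq]

theorem comap_dist_zero_atTop : comap (fun x : ℝ≥0 => dist 0 x) atTop = (atTop : Filter ℝ≥0) := by
  simp_rw [dist_zero_coe]
  exact NNReal.comap_coe_atTop

/-- A function in `C_P` has small oscillation on balls of radius `x ^ α` for one fixed `α > 0`. A
failure along the exponents `1 / (n + 1)` yields points `x n → ∞`, and a subpower function `s` with
`s (x n) ≥ x n ^ (1 / (n + 1))`, along which the diameters stay large. -/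
theorem HigsonSubpower.exists_rpow {f : ℝ≥0 →ᵇ ℝ} (hf : HigsonSubpower 0 f) {ε : ℝ}
    (hε : 0 < ε) : ∃ α : ℝ, 0 < α ∧
      ∀ᶠ x : ℝ≥0 in atTop, ∀ y : ℝ≥0, dist y x ≤ (x : ℝ) ^ α → dist (f y) (f x) < ε := by
  by_contra! hcon
  have hex : ∀ n : ℕ, ∃ x : ℝ≥0, (n + 2 : ℝ≥0) ≤ x ∧
      ∃ y : ℝ≥0, dist y x ≤ (x : ℝ) ^ (1 / ((n : ℝ) + 1)) ∧ ε ≤ dist (f y) (f x) := by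
    intro n
    have h := hcon (1 / ((n : ℝ) + 1)) (by positivity)
    obtain ⟨x, h1, h2⟩ := (h.and_eventually (eventually_ge_atTop (n + 2 : ℝ≥0))).exists
    exact ⟨x, h2, h1⟩
  choose x hx y hy hfar using hex
  have hx' : ∀ n : ℕ, (n + 2 : ℝ) ≤ x n := fun n => by exact_mod_cast hx n
  have hx1 : ∀ n, (1 : ℝ) < x n := fun n => by
    have := hx' n; have : (0 : ℝ) ≤ n := n.cast_nonneg; linarith
  classical
  -- Taking the least index makes `s` well defined although `x` need not be injective.
  let s : ℝ → ℝ := fun t =>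
    if h : ∃ n, (x n : ℝ) = t then t ^ (1 / ((Nat.find h : ℝ) + 1)) else 1
  have hs : AsymptoticallySubpower s := by
    refine ⟨fun t ht => ?_, fun α hα => ?_⟩
    · simp only [s]; split_ifs
      · positivity
      · exact one_pos
    · obtain ⟨k, hk⟩ := exists_nat_one_div_lt hα
      obtain ⟨M, hM⟩ := ((Set.finite_Iic k).image (fun n => (x n : ℝ))).bddAbove
      refine ⟨max 1 M, by positivity, fun t ht => ?_⟩
      have ht1 : 1 < t := (le_max_left _ _).trans_lt ht
      simp only [s]; split_ifs with h
      · refine Real.rpow_lt_rpow_of_exponent_lt ht1 (lt_of_le_of_lt ?_ hk)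
        have hlt : k < Nat.find h := by
          by_contra! hle
          have := hM (Set.mem_image_of_mem (fun n => (x n : ℝ)) (Set.mem_Iic.2 hle))
          simp only [Nat.find_spec h] at this
          exact absurd (le_max_right 1 M) (not_le.2 (ht.trans_le this))
        have : (k : ℝ) ≤ Nat.find h := by exact_mod_cast hlt.le
        gcongr
      · exact Real.one_lt_rpow ht1 hα
  have hlim := hf s hs
  rw [comap_dist_zero_atTop] at hlim
  have hxt : Tendsto x atTop atTop :=
    tendsto_atTop_mono (fun n => (le_add_of_nonneg_right (by positivity)).trans (hx n))
      tendsto_natCast_atTop_atTop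
  obtain ⟨n, hn⟩ := ((hlim.comp hxt).eventually (gt_mem_nhds hε)).exists
  refine absurd hn (not_lt.2 ((hfar n).trans ?_))
  have hball : (x n : ℝ) ^ (1 / ((n : ℝ) + 1)) ≤ s (x n) := by
    have h : ∃ m, (x m : ℝ) = x n := ⟨n, rfl⟩
    simp only [s, dif_pos h]
    have : (Nat.find h : ℝ) ≤ n := by exact_mod_cast Nat.find_min' h rfl
    refine Real.rpow_le_rpow_of_exponent_le (hx1 n).le ?_
    gcongr
  refine Metric.dist_le_diam_of_mem (f.isBounded_range.subset (image_subset_range _ _)) ?_ ?_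
  · refine mem_image_of_mem _ (Metric.mem_closedBall.2 ?_)
    rw [dist_zero_coe]; exact (hy n).trans hball
  · refine mem_image_of_mem _ (Metric.mem_closedBall_self ?_)
    rw [dist_zero_coe]; exact (hs.1 _ (zero_lt_one.trans (hx1 n))).le

/-- The smallness holds for all small exponents, so that finitely many functions share one. -/
theorem HigsonSubpower.eventually_rpow {f : ℝ≥0 →ᵇ ℝ} (hf : HigsonSubpower 0 f) {ε : ℝ}
    (hε : 0 < ε) : ∀ᶠ α : ℝ in 𝓝[>] 0, ∀ᶠ x : ℝ≥0 in atTop, ∀ y : ℝ≥0,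
      dist y x ≤ (x : ℝ) ^ α → dist (f y) (f x) < ε := by
  obtain ⟨β, hβ, h⟩ := hf.exists_rpow hε
  filter_upwards [Ioc_mem_nhdsGT hβ] with α hα
  filter_upwards [h, eventually_ge_atTop 1] with x hx hx1 y hy
  exact hx y (hy.trans (Real.rpow_le_rpow_of_exponent_le (by exact_mod_cast hx1) hα.2))

/-- A function whose slopes decay like a negative power of the distance to the base point belongs
to `C_P`. -/
theorem higsonSubpower_of_dist_le {f : ℝ≥0 →ᵇ ℝ} {α C : ℝ} (hα : 0 < α) (hC : 0 ≤ C)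
    (h : ∀ x y : ℝ≥0, dist (f y) (f x) ≤ C * dist y x / (1 + (x : ℝ)) ^ α) :
    HigsonSubpower 0 f := by
  intro s hs
  rw [comap_dist_zero_atTop]
  obtain ⟨t₀, ht₀, hst⟩ := hs.2 (α / 2) (by positivity)
  have hcoe : Tendsto (fun x : ℝ≥0 => 1 + (x : ℝ)) atTop atTop :=
    tendsto_atTop_add_const_left _ _ (NNReal.tendsto_coe_atTop.2 tendsto_id)
  have hlim : Tendsto (fun x : ℝ≥0 => 2 * (C * (1 + (x : ℝ)) ^ (-(α / 2)))) atTop (𝓝 0) := by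
    have := ((tendsto_rpow_neg_atTop (y := α / 2) (by positivity)).comp hcoe).const_mul (2 * C)
    simpa [Function.comp_def, mul_assoc] using this
  refine squeeze_zero' (Eventually.of_forall fun _ => Metric.diam_nonneg) ?_ hlim
  filter_upwards [NNReal.tendsto_coe_atTop.2 tendsto_id |>.eventually_gt_atTop t₀] with x hx
  have hx1 : (0 : ℝ) < 1 + x := by positivity
  have key : ∀ y ∈ Metric.closedBall x (s (dist 0 x)),
      dist (f y) (f x) ≤ C * (1 + (x : ℝ)) ^ (-(α / 2)) := by
    intro y hy
    have hyx : dist y x ≤ (1 + (x : ℝ)) ^ (α / 2) := by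
      refine (Metric.mem_closedBall.1 hy).trans ?_
      rw [dist_zero_coe]
      refine (hst x hx).le.trans ?_
      gcongr
      linarith
    refine (h x y).trans ?_
    rw [mul_div_assoc]
    refine mul_le_mul_of_nonneg_left ?_ hC
    rw [div_le_iff₀ (by positivity), ← Real.rpow_add hx1]
    rwa [show -(α / 2) + α = α / 2 by ring]
  refine Metric.diam_le_of_forall_dist_le (by positivity) ?_
  rintro _ ⟨y, hy, rfl⟩ _ ⟨z, hz, rfl⟩
  refine (dist_triangle_right _ _ (f x)).trans ?_
  linarith [key y hy, key z hz]

/-- The weight `(1 + x) ^ α` is `1`-Lipschitz for `α ≤ 1`, by Bernoulli's inequality. -/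
theorem abs_one_add_rpow_sub_le {α : ℝ} (hα : 0 < α) (hα1 : α ≤ 1) (x y : ℝ≥0) :
    |(1 + (y : ℝ)) ^ α - (1 + (x : ℝ)) ^ α| ≤ dist y x := by
  wlog hxy : x ≤ y generalizing x y
  · rw [abs_sub_comm, dist_comm]; exact this y x (le_of_not_ge hxy)
  have hxy' : (x : ℝ) ≤ y := by exact_mod_cast hxy
  have hx : (1 : ℝ) ≤ 1 + x := by simp
  have hx0 : (0 : ℝ) < 1 + x := by linarith
  rw [NNReal.dist_eq, abs_of_nonneg (by linarith : (0 : ℝ) ≤ (y : ℝ) - x), abs_of_nonneg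
    (sub_nonneg.2 (by gcongr))]
  have hd : 0 ≤ ((y : ℝ) - x) / (1 + x) := div_nonneg (by linarith) hx0.le
  have hb := rpow_one_add_le_one_add_mul_self (s := ((y : ℝ) - x) / (1 + x))
    (by linarith) hα.le hα1
  have heq : (1 + (y : ℝ)) = (1 + x) * (1 + ((y : ℝ) - x) / (1 + x)) := by field_simp; ring
  have hle : (1 + (x : ℝ)) ^ α ≤ 1 + x := by
    simpa using Real.rpow_le_rpow_of_exponent_le hx hα1
  have h0 : 0 < (1 + (x : ℝ)) ^ α := by positivity
  rw [heq, Real.mul_rpow hx0.le (by linarith)]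
  have h1 : (1 + (x : ℝ)) ^ α * (α * (((y : ℝ) - x) / (1 + x))) ≤ (y : ℝ) - x := by
    calc (1 + (x : ℝ)) ^ α * (α * (((y : ℝ) - x) / (1 + x)))
        ≤ (1 + x) * (1 * (((y : ℝ) - x) / (1 + x))) := by gcongr
      _ = (y : ℝ) - x := by field_simp
  nlinarith [mul_le_mul_of_nonneg_left hb h0.le]

/-- A Urysohn lemma for `C_P`: sets whose mutual distance grows at least like a power of the
distance to the base point are separated by a function in `C_P`. -/
theorem exists_subpower_separation {α c : ℝ} (hα : 0 < α) (hα1 : α ≤ 1) (hc : 0 < c)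
    (hc1 : c ≤ 1) {E O : Set ℝ≥0} (hE : E.Nonempty)
    (hsep : ∀ x ∈ O, ∀ y ∈ E, c * (1 + (x : ℝ)) ^ α ≤ dist x y) :
    ∃ g ∈ subpowerFunctions (0 : ℝ≥0), (∀ x ∈ E, g x = 0) ∧ ∀ x ∈ O, g x = 1 := by
  set w : ℝ≥0 → ℝ := fun x => c * (1 + (x : ℝ)) ^ α with hw
  have hw0 : ∀ x, 0 < w x := fun x => by positivity
  have hwlip : ∀ x y, |w y - w x| ≤ dist y x := fun x y => by
    rw [hw]; dsimp only
    rw [← mul_sub, abs_mul, abs_of_pos hc]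
    exact (mul_le_of_le_one_left (abs_nonneg _) hc1).trans (abs_one_add_rpow_sub_le hα hα1 x y)
  -- Truncating the distance to `E` at the weight keeps the quotient by the weight in `[0, 1]`, which
  -- makes the variation of the denominator harmless in `hlip`.
  set m : ℝ≥0 → ℝ := fun x => min (Metric.infDist x E) (w x) with hm
  have hm0 : ∀ x, 0 ≤ m x := fun x => le_min Metric.infDist_nonneg (hw0 x).le
  have hmlip : ∀ x y, |m y - m x| ≤ dist y x := fun x y => by
    refine (abs_min_sub_min_le_max _ _ _ _).trans (max_le ?_ (hwlip x y))
    exact (Metric.lipschitz_infDist_pt E).dist_le_mul y x |>.trans (by simp)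
  have hlip : ∀ x y, |m y / w y - m x / w x| ≤ 2 * dist y x / w x := by
    intro x y
    have hq1 : m y / w y ≤ 1 := (div_le_one (hw0 y)).2 (min_le_right _ _)
    have hq0 : 0 ≤ m y / w y := div_nonneg (hm0 y) (hw0 y).le
    rw [le_div_iff₀ (hw0 x), ← abs_of_pos (hw0 x), ← abs_mul, abs_of_pos (hw0 x)]
    have hid : (m y / w y - m x / w x) * w x = (m y - m x) - m y / w y * (w y - w x) := by
      have := (hw0 x).ne'; have := (hw0 y).ne'
      field_simp; ring
    rw [hid]
    refine (abs_sub _ _).trans ?_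
    rw [abs_mul, abs_of_nonneg hq0, two_mul]
    exact add_le_add (hmlip x y) ((mul_le_of_le_one_left (abs_nonneg _) hq1).trans (hwlip x y))
  have hcont : Continuous fun x => m x / w x := by
    refine Continuous.div ?_ ?_ fun x => (hw0 x).ne'
    · exact (LipschitzWith.of_dist_le_mul (K := 1) fun y x => by
        rw [Real.dist_eq]; simpa using hmlip x y).continuous
    · exact (LipschitzWith.of_dist_le_mul (K := 1) fun y x => by
        rw [Real.dist_eq]; simpa using hwlip x y).continuous
  refine ⟨BoundedContinuousFunction.ofNormedAddCommGroup _ hcont 1 fun x => ?_, ?_, ?_, ?_⟩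
  · rw [Real.norm_eq_abs, abs_of_nonneg (div_nonneg (hm0 x) (hw0 x).le)]
    exact (div_le_one (hw0 x)).2 (min_le_right _ _)
  · refine higsonSubpower_of_dist_le (C := 2 / c) hα (by positivity) fun x y => ?_
    rw [Real.dist_eq]
    refine (hlip x y).trans_eq ?_
    have : 0 < (1 + (x : ℝ)) ^ α := by positivity
    simp only [hw]; field_simp
  · intro x hx
    have : m x = 0 := by
      simp only [hm, Metric.infDist_zero_of_mem hx]; exact min_eq_left (hw0 x).le
    simp [this]
  · intro x hx
    have : m x = w x :=
      min_eq_right ((Metric.le_infDist hE).2 fun {y} hy => hsep x hx y hy)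
    simpa [this] using (hw0 x).ne'

/-! ### The corona as a set of limits at infinity -/

theorem exists_inv_one_add_mem_subpowerFunctions :
    ∃ f ∈ subpowerFunctions (0 : ℝ≥0), ∀ x, f x = (1 + (x : ℝ))⁻¹ := by
  have hcont : Continuous fun x : ℝ≥0 => (1 + (x : ℝ))⁻¹ :=
    Continuous.inv₀ (by fun_prop) fun x => by positivity
  refine ⟨BoundedContinuousFunction.ofNormedAddCommGroup _ hcont 1 fun x => ?_, ?_, fun _ => rfl⟩
  · rw [Real.norm_of_nonneg (by positivity)]
    exact inv_le_one_of_one_le₀ (by simp)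
  · refine higsonSubpower_of_dist_le (α := 1) (C := 1) one_pos zero_le_one fun x y => ?_
    have hx : (0 : ℝ) < 1 + x := by positivity
    have hy : (1 : ℝ) ≤ 1 + y := by simp
    have hy0 : (0 : ℝ) < 1 + y := by positivity
    change dist (1 + (y : ℝ))⁻¹ (1 + (x : ℝ))⁻¹ ≤ _
    rw [Real.dist_eq, inv_sub_inv hy0.ne' hx.ne', abs_div, abs_of_pos (mul_pos hy0 hx),
      Real.rpow_one, one_mul, NNReal.dist_eq, ← abs_neg]
    rw [show -(1 + (x : ℝ) - (1 + y)) = y - x by ring]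
    gcongr
    exact le_mul_of_one_le_left hx.le hy

/-- The product of intervals in which the compactification of the half-line lives. -/
abbrev Cube : Type := ∀ f : subpowerFunctions (0 : ℝ≥0), valueInterval f.1

/-- The evaluation map of the half-line. -/
abbrev ev : ℝ≥0 → Cube := evalMap (subpowerFunctions (0 : ℝ≥0))

theorem continuous_ev : Continuous ev :=
  continuous_pi fun f => f.1.continuous.subtype_mk _

theorem continuous_coord (f : subpowerFunctions (0 : ℝ≥0)) :
    Continuous fun r : Cube => (r f : ℝ) :=
  continuous_subtype_val.comp (continuous_apply f)

/-- The element `x ↦ 1 / (1 + x)` of `C_P`, which cuts out the corona as a zero set. -/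
noncomputable def decay : subpowerFunctions (0 : ℝ≥0) :=
  ⟨exists_inv_one_add_mem_subpowerFunctions.choose,
    exists_inv_one_add_mem_subpowerFunctions.choose_spec.1⟩

theorem ev_decay (x : ℝ≥0) : (ev x decay : ℝ) = (1 + (x : ℝ))⁻¹ :=
  exists_inv_one_add_mem_subpowerFunctions.choose_spec.2 x

/-- The corona consists of the limit points of the ends of the half-line: initial segments are
compact, and `decay` tells a point of the half-line from the limits of far ends. -/
theorem mem_corona_iff_forall {r : Cube} :
    r ∈ corona (0 : ℝ≥0) ↔ ∀ n : ℕ, r ∈ closure (ev '' Ici (n : ℝ≥0)) := by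
  constructor
  · rintro ⟨hr, hr'⟩ n
    have hcov : range ev ⊆ ev '' Icc 0 (n : ℝ≥0) ∪ ev '' Ici (n : ℝ≥0) := by
      rintro _ ⟨x, rfl⟩
      rcases le_total x n with h | h
      · exact Or.inl ⟨x, ⟨zero_le, h⟩, rfl⟩
      · exact Or.inr ⟨x, h, rfl⟩
    have h := closure_mono hcov hr
    rw [closure_union, (isCompact_Icc.image continuous_ev).isClosed.closure_eq] at h
    exact h.resolve_left fun h => hr' (image_subset_range _ _ h)
  · intro h
    refine ⟨closure_mono (image_subset_range _ _) (h 0), ?_⟩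
    rintro ⟨x, rfl⟩
    obtain ⟨n, hn⟩ := exists_nat_gt x
    have hcl : IsClosed {r : Cube | (r decay : ℝ) ≤ (1 + (n : ℝ))⁻¹} :=
      isClosed_le (continuous_coord _) continuous_const
    have hsub : ev '' Ici (n : ℝ≥0) ⊆ {r : Cube | (r decay : ℝ) ≤ (1 + (n : ℝ))⁻¹} := by
      rintro _ ⟨y, hy, rfl⟩
      have hy' : (n : ℝ) ≤ y := by exact_mod_cast hy
      rw [Set.mem_ofPred_eq, ev_decay]
      gcongr
    have h1 : (ev x decay : ℝ) ≤ (1 + (n : ℝ))⁻¹ := closure_minimal hsub hcl (h n)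
    have hn' : (x : ℝ) < n := by exact_mod_cast hn
    rw [ev_decay] at h1
    exact absurd h1 (not_le.2 (by gcongr))

theorem corona_eq_iInter :
    corona (0 : ℝ≥0) = ⋂ n : ℕ, closure (ev '' Ici (n : ℝ≥0)) := by
  ext r; rw [mem_corona_iff_forall, mem_iInter]

theorem isClosed_corona : IsClosed (corona (0 : ℝ≥0)) := by
  rw [corona_eq_iInter]; exact isClosed_iInter fun _ => isClosed_closure

theorem exists_gt_ev_mem {p : Cube} (hp : p ∈ corona (0 : ℝ≥0)) {U : Set Cube} (hU : U ∈ 𝓝 p)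
    (M : ℝ≥0) : ∃ x, M < x ∧ ev x ∈ U := by
  obtain ⟨n, hn⟩ := exists_nat_gt M
  obtain ⟨_, hU, x, hx, rfl⟩ := mem_closure_iff_nhds.1 (mem_corona_iff_forall.1 hp n) U hU
  exact ⟨x, hn.trans_le hx, hU⟩

/-- A sequence tending to infinity has a cluster point, and it lies in the corona. The cluster point
is described by the closed sets containing it. -/
theorem exists_mem_corona_of_tendsto {a : ℕ → ℝ≥0} (ha : Tendsto a atTop atTop) :
    ∃ r ∈ corona (0 : ℝ≥0), ∀ C : Set Cube, IsClosed C → (∀ᶠ n in atTop, ev (a n) ∈ C) → r ∈ C := by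
  obtain ⟨r, hr⟩ := exists_clusterPt_of_compactSpace (map (ev ∘ a) atTop)
  have key : ∀ C : Set Cube, IsClosed C → (∀ᶠ n in atTop, ev (a n) ∈ C) → r ∈ C :=
    fun C hC h => isClosed_iff_clusterPt.1 hC r (hr.mono (le_principal_iff.2 h))
  refine ⟨r, mem_corona_iff_forall.2 fun n => key _ isClosed_closure ?_, key⟩
  filter_upwards [ha.eventually_ge_atTop (n : ℝ≥0)] with k hk
  exact subset_closure (mem_image_of_mem _ hk)

/-! ### Connectedness of the corona -/

/-- A decreasing intersection of compact connected sets is connected. -/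
theorem isPreconnected_iInter_of_antitone {Y : Type*} [TopologicalSpace Y] [T2Space Y]
    {K : ℕ → Set Y} (hK : Antitone K) (hc : ∀ n, IsCompact (K n))
    (hp : ∀ n, IsPreconnected (K n)) : IsPreconnected (⋂ n, K n) := by
  have hcl : IsClosed (⋂ n, K n) := isClosed_iInter fun n => (hc n).isClosed
  have hcpt : IsCompact (⋂ n, K n) := (hc 0).of_isClosed_subset hcl (iInter_subset _ 0)
  rw [isPreconnected_iff_subset_of_fully_disjoint_closed hcl]
  intro s t hs ht hst hdisj
  obtain ⟨u, v, hu, hv, hsu, htv, huv⟩ := SeparatedNhds.of_isCompact_isCompact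
    (hcpt.inter_right hs) (hcpt.inter_right ht) (hdisj.mono inter_subset_right inter_subset_right)
  obtain ⟨n, hn⟩ := exists_subset_nhds_of_isCompact (U := u ∪ v)
    (directed_of_isDirected_le hK) hc fun x hx => (hu.union hv).mem_nhds
      ((hst hx).imp (fun h => hsu ⟨hx, h⟩) fun h => htv ⟨hx, h⟩)
  rcases (isPreconnected_iff_subset_of_disjoint.1 (hp n)) u v hu hv hn
    (by rw [huv.inter_eq, inter_empty]) with h | h
  · refine Or.inl fun x hx => (hst hx).resolve_right fun hxt => ?_
    exact disjoint_left.1 huv (h (mem_iInter.1 hx n)) (htv ⟨hx, hxt⟩)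
  · refine Or.inr fun x hx => (hst hx).resolve_left fun hxs => ?_
    exact disjoint_left.1 huv (hsu ⟨hx, hxs⟩) (h (mem_iInter.1 hx n))

theorem isContinuum_corona : IsContinuum (corona (0 : ℝ≥0)) := by
  have hne : (corona (0 : ℝ≥0)).Nonempty :=
    (exists_mem_corona_of_tendsto (a := fun n => (n : ℝ≥0)) tendsto_natCast_atTop_atTop).imp
      fun _ h => h.1
  refine ⟨hne.to_subtype, isCompact_iff_compactSpace.1 isClosed_corona.isCompact,
    isConnected_iff_connectedSpace.1 ⟨hne, ?_⟩, inferInstance⟩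
  rw [corona_eq_iInter]
  refine isPreconnected_iInter_of_antitone (fun m n hmn => ?_)
    (fun n => isClosed_closure.isCompact)
    fun n => (isPreconnected_Ici.image _ continuous_ev.continuousOn).closure
  exact closure_mono (image_mono (Ici_subset_Ici.2 (by exact_mod_cast hmn)))

/-! ### Non-metrizability -/

/-- From a countable neighbourhood basis at a point `p` of the corona one gets a sequence `a` of
points of the half-line, growing as fast as one likes, such that every subsequence of `ev ∘ a` has
`p` as its only cluster point; a `C_P` function equal to `0` at the even and to `1` at the odd terms
contradicts this. -/
theorem not_metrizableSpace_corona :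
    ¬ TopologicalSpace.MetrizableSpace (corona (0 : ℝ≥0)) := by
  intro hmet
  obtain ⟨⟨⟨p, hp⟩⟩, -, -, -⟩ := isContinuum_corona
  obtain ⟨b, hb⟩ := (𝓝 (⟨p, hp⟩ : corona (0 : ℝ≥0))).exists_antitone_basis
  -- Closed neighbourhoods of `p` in the cube whose traces on the corona form a basis at `p`.
  have hV : ∀ n, ∃ V ∈ 𝓝 p, IsClosed V ∧ Subtype.val ⁻¹' V ⊆ b n := by
    intro n
    have := hb.mem n
    rw [nhds_subtype, mem_comap] at this
    obtain ⟨t, ht, htb⟩ := this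
    obtain ⟨V, hV, hVc, hVt⟩ := exists_mem_nhds_isClosed_subset ht
    exact ⟨V, hV, hVc, (preimage_mono hVt).trans htb⟩
  choose V hVn hVc hVb using hV
  have hW : ∀ n, (⋂ k ∈ Iic n, V k) ∈ 𝓝 p := fun n =>
    (biInter_mem (finite_Iic n)).2 fun k _ => hVn k
  choose φ hφ hφV using fun n M => exists_gt_ev_mem hp (hW n) M
  let a : ℕ → ℝ≥0 := fun n => Nat.rec (φ 0 0) (fun n x => φ (n + 1) (2 * x + 1)) n
  have ha1 : ∀ n, 2 * a n + 1 < a (n + 1) := fun n => hφ (n + 1) _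
  have haV : ∀ n k, k ≤ n → ev (a n) ∈ V k := by
    intro n k hk
    have : ev (a n) ∈ ⋂ k ∈ Iic n, V k := by
      cases n with
      | zero => exact hφV 0 _
      | succ n => exact hφV (n + 1) _
    exact mem_iInter₂.1 this k hk
  clear_value a
  have hamono : StrictMono a := strictMono_nat_of_lt_succ fun n => by
    refine lt_of_le_of_lt ?_ (ha1 n)
    rw [two_mul, add_assoc]; exact le_self_add
  have hge : ∀ n : ℕ, (n : ℝ≥0) ≤ a n := by
    intro n
    induction n with
    | zero => simp
    | succ n ih =>
      push_cast
      refine le_trans ?_ (ha1 n).le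
      gcongr
      rw [two_mul]; exact ih.trans le_self_add
  have hat : Tendsto a atTop atTop := tendsto_atTop_mono hge tendsto_natCast_atTop_atTop
  have hlt : ∀ m n : ℕ, m < n → 2 * (a m : ℝ) + 1 ≤ a n := fun m n hmn => by
    have := (ha1 m).le.trans (hamono.monotone (Nat.succ_le_of_lt hmn))
    exact_mod_cast this
  obtain ⟨g, hg, hg0, hg1⟩ := exists_subpower_separation (α := 1) (c := 1 / 3)
    (E := range fun n => a (2 * n)) (O := range fun n => a (2 * n + 1)) one_pos le_rfl
    (by norm_num) (by norm_num) (range_nonempty _) (by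
      rintro _ ⟨m, rfl⟩ _ ⟨n, rfl⟩
      dsimp only
      rw [Real.rpow_one, NNReal.dist_eq, le_abs]
      have h0 : (0 : ℝ) ≤ a (2 * m + 1) := NNReal.coe_nonneg _
      have h0' : (0 : ℝ) ≤ a (2 * n) := NNReal.coe_nonneg _
      rcases lt_or_gt_of_ne (show 2 * m + 1 ≠ 2 * n by omega) with h | h
      · right; linarith [hlt _ _ h]
      · left; linarith [hlt _ _ h])
  have huniq : ∀ σ : ℕ → ℕ, StrictMono σ → ∀ c : ℝ, (∀ n, g (a (σ n)) = c) →
      (p ⟨g, hg⟩ : ℝ) = c := by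
    intro σ hσ c hc
    obtain ⟨r, hr, hrC⟩ := exists_mem_corona_of_tendsto (hat.comp hσ.tendsto_atTop)
    have hrV : ∀ k, r ∈ V k := fun k => hrC _ (hVc k) <| by
      filter_upwards [eventually_ge_atTop k] with n hn
      exact haV _ _ (hn.trans hσ.le_apply)
    have hrp : (⟨p, hp⟩ : corona (0 : ℝ≥0)) = ⟨r, hr⟩ := by
      by_contra hne
      obtain ⟨k, -, hk⟩ := hb.toHasBasis.mem_iff.1 (isOpen_ne.mem_nhds hne)
      exact hk (hVb k (hrV k)) rfl
    rw [show p = r from congrArg Subtype.val hrp]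
    exact hrC {q | (q ⟨g, hg⟩ : ℝ) = c} (isClosed_eq (continuous_coord _) continuous_const)
      (Eventually.of_forall hc)
  have h0 := huniq (fun n => 2 * n) (fun _ _ h => by dsimp only; omega) 0 fun n =>
    hg0 _ (mem_range_self n)
  have h1 := huniq (fun n => 2 * n + 1) (fun _ _ h => by dsimp only; omega) 1 fun n =>
    hg1 _ (mem_range_self n)
  exact zero_ne_one (h0.symm.trans h1)

/-! ### Indecomposability -/

/-- Balls of radius `x ^ α` around far points `x` near `q` stay in a given neighbourhood of `q`, if
`α` is small: only finitely many coordinates matter, and each satisfies `eventually_rpow`. -/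
theorem exists_nhds_rpow_ball_subset {q : Cube} {U : Set Cube} (hU : U ∈ 𝓝 q) :
    ∃ U' ∈ 𝓝 q, ∃ α : ℝ, 0 < α ∧ α ≤ 1 ∧
      ∀ᶠ x : ℝ≥0 in atTop, ev x ∈ U' → ∀ y, dist y x ≤ (x : ℝ) ^ α → ev y ∈ U := by
  rw [nhds_pi, Filter.mem_pi'] at hU
  obtain ⟨I, t, ht, hI⟩ := hU
  have hball : ∀ f, ∃ ε > 0, Metric.ball (q f) ε ⊆ t f := fun f => Metric.mem_nhds_iff.1 (ht f)
  choose ε hε hεt using hball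
  have hsmall : ∀ᶠ α : ℝ in 𝓝[>] 0, ∀ f ∈ I, ∀ᶠ x : ℝ≥0 in atTop, ∀ y : ℝ≥0,
      dist y x ≤ (x : ℝ) ^ α → dist (f.1 y) (f.1 x) < ε f / 2 :=
    (eventually_all_finset I).2 fun f _ =>
      HigsonSubpower.eventually_rpow f.2 (half_pos (hε f))
  obtain ⟨α, hα, hα0, hα1⟩ := (hsmall.and (Ioc_mem_nhdsGT one_pos)).exists
  refine ⟨⋂ f ∈ I, {r | dist (r f) (q f) < ε f / 2}, ?_, α, hα0, hα1, ?_⟩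
  · refine (biInter_finset_mem I).2 fun f _ => ?_
    exact (isOpen_lt ((continuous_apply f).dist continuous_const) continuous_const).mem_nhds
      (by simpa using hε f)
  · filter_upwards [(eventually_all_finset I).2 hα] with x hx hxU y hy
    refine hI fun f hf => hεt f ?_
    have h1 : dist (ev x f) (q f) < ε f / 2 := mem_iInter₂.1 hxU f hf
    have h2 : dist (ev y f) (ev x f) < ε f / 2 := hx f hf y hy
    rw [Metric.mem_ball]
    linarith [dist_triangle (ev y f) (ev x f) (q f)]

/-- Two points outside the balls of radius `b ^ α` around a point `b ≥ 1` between them are at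
distance at least comparable to a power of the larger one. -/
theorem one_add_rpow_le_of_between {α : ℝ} (hα : 0 < α) (hα1 : α ≤ 1) {x b y : ℝ}
    (hb : 1 ≤ b) (hx : x + b ^ α < b) (hy : b + b ^ α < y) :
    1 / 2 * (1 + y) ^ α ≤ y - x := by
  have hbα : 1 ≤ b ^ α := Real.one_le_rpow hb hα.le
  have h1 : (1 + y) ^ α ≤ (1 + b ^ α) + (y - b) := by
    calc (1 + y) ^ α = (1 + b + (y - b)) ^ α := by ring_nf
      _ ≤ (1 + b) ^ α + (y - b) ^ α :=
        Real.rpow_add_le_add_rpow (by linarith) (by linarith) hα.le hα1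
      _ ≤ (1 ^ α + b ^ α) + (y - b) ^ (1 : ℝ) := by
        gcongr
        · exact Real.rpow_add_le_add_rpow (by linarith) (by linarith) hα.le hα1
        · linarith
      _ = _ := by rw [Real.one_rpow, Real.rpow_one]
  linarith

/-- No proper closed subset `A` of the corona having interior there is connected, the interior
being witnessed by a closed `B` that covers the rest: between far points near `A \ B` insert far
points near a point `q ∉ A`. The inserted points come with whole balls of radius `b ^ α` which are
not near `A`, so a `C_P` function may switch between `0` and `1` inside them. It takes only the
values `0` and `1` on `A`, and both of them. -/
theorem not_isPreconnected_of_union_eq {A B : Set Cube} (hA : IsClosed A) (hB : IsClosed B)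
    (hAB : A ∪ B = corona (0 : ℝ≥0)) {p q : Cube} (hp : p ∈ corona (0 : ℝ≥0)) (hpB : p ∉ B)
    (hq : q ∈ corona (0 : ℝ≥0)) (hqA : q ∉ A) : ¬ IsPreconnected A := by
  intro hconn
  obtain ⟨V, W, hV, hW, hAV, hqW, hVW⟩ := SeparatedNhds.of_isCompact_isCompact hA.isCompact
    isCompact_singleton (disjoint_singleton_right.2 hqA)
  rw [singleton_subset_iff] at hqW
  obtain ⟨P, hP, hPc, hPB⟩ := exists_mem_nhds_isClosed_subset (hB.isOpen_compl.mem_nhds hpB)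
  have hpA : p ∈ A := ((hAB ▸ hp : p ∈ A ∪ B)).resolve_right hpB
  obtain ⟨W', hW', α, hα, hα1, hball⟩ := exists_nhds_rpow_ball_subset (hW.mem_nhds hqW)
  obtain ⟨M, hM⟩ := eventually_atTop.1 hball
  choose φ hφ hφP using exists_gt_ev_mem hp (inter_mem (hV.mem_nhds (hAV hpA)) hP)
  choose ψ hψ hψW using exists_gt_ev_mem hq hW'
  let b : ℕ → ℝ≥0 := fun n => Nat.rec (ψ (max M 1)) (fun _ x => ψ (φ x + 1)) n
  have hbW : ∀ n, ev (b n) ∈ W' := fun n => by cases n <;> exact hψW _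
  have hba : ∀ n, b n < φ (b n) := fun n => hφ _
  have hab : ∀ n, φ (b n) + 1 < b (n + 1) := fun n => hψ _
  have hb00 : max M 1 ≤ b 0 := (hψ _).le
  clear_value b
  have hbsucc : ∀ n, b n + 1 ≤ b (n + 1) := fun n =>
    (add_le_add_left (hba n).le 1).trans (hab n).le
  have hbmono : StrictMono b := strictMono_nat_of_lt_succ fun n =>
    (lt_add_one _).trans_le (hbsucc n)
  have hb0 : ∀ n, max M 1 ≤ b n := fun n => hb00.trans (hbmono.monotone n.zero_le)
  have hbn : ∀ n : ℕ, (n : ℝ≥0) ≤ b n := by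
    intro n
    induction n with
    | zero => simp
    | succ n ih => push_cast; exact (add_le_add_left ih 1).trans (hbsucc n)
  have hex : ∀ x : ℝ≥0, ∃ n, x < b n := fun x =>
    (exists_nat_gt x).imp fun n hn => hn.trans_le (hbn n)
  classical
  -- `N x` is the number of terms `b n ≤ x`.
  let N : ℝ≥0 → ℕ := fun x => Nat.find (hex x)
  have hN : ∀ n, N (φ (b n)) = n + 1 := fun n => by
    refine (Nat.find_eq_iff _).2 ⟨(lt_add_one _).trans (hab n), fun k hk => not_lt.2 ?_⟩
    exact (hbmono.monotone (Nat.le_of_lt_succ hk)).trans (hba n).le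
  have hfar : ∀ x n, ev x ∉ W → (b n : ℝ) ^ α < dist x (b n) := fun x n hx => by
    by_contra! h
    exact hx (hM _ ((le_max_left _ _).trans (hb0 n)) (hbW n) x h)
  have hlt : ∀ x y, ev x ∉ W → ev y ∉ W → N x < N y →
      1 / 2 * (1 + (y : ℝ)) ^ α ≤ y - x := by
    intro x y hx hy hxy
    have h1 : x < b (N x) := Nat.find_spec (hex x)
    have h2 : b (N x) ≤ y := not_lt.1 (Nat.find_min (hex y) (m := N x) hxy)
    have h1' : (x : ℝ) < b (N x) := by exact_mod_cast h1
    have h2' : (b (N x) : ℝ) ≤ y := by exact_mod_cast h2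
    have h3 := hfar x (N x) hx
    have h4 := hfar y (N x) hy
    rw [NNReal.dist_eq, abs_of_neg (by linarith)] at h3
    rw [NNReal.dist_eq, abs_of_nonneg (by linarith)] at h4
    have h5 : (1 : ℝ) ≤ b (N x) := by exact_mod_cast (le_max_right M 1).trans (hb0 _)
    exact one_add_rpow_le_of_between hα hα1 h5 (by linarith) (by linarith)
  have hφW : ∀ n, ev (φ (b n)) ∉ W := fun n => disjoint_left.1 hVW (hφP (b n)).1
  -- Off `W`, the parity of `N` changes only across a ball of radius `b n ^ α`.
  obtain ⟨g, hg, hg0, hg1⟩ := exists_subpower_separation hα hα1 (c := 1 / 2)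
    (E := {x | ev x ∉ W ∧ Even (N x)}) (O := {x | ev x ∉ W ∧ ¬ Even (N x)})
    (by norm_num) (by norm_num)
    ⟨φ (b 1), hφW 1, by rw [hN]; decide⟩ (by
      rintro x ⟨hx, hxN⟩ y ⟨hy, hyN⟩
      rcases lt_trichotomy (N x) (N y) with h | h | h
      · have h1 := hlt x y hx hy h
        have h0 : 0 ≤ (y : ℝ) - x := le_trans (by positivity) h1
        rw [dist_comm, NNReal.dist_eq, abs_of_nonneg h0]
        refine le_trans ?_ h1
        have : (x : ℝ) ≤ y := by linarith
        gcongr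
      · exact absurd (h ▸ hyN) hxN
      · rw [NNReal.dist_eq]
        exact (hlt y x hy hx h).trans (le_abs_self _))
  have h01 : ∀ r ∈ A, (r ⟨g, hg⟩ : ℝ) = 0 ∨ (r ⟨g, hg⟩ : ℝ) = 1 := by
    intro r hr
    have hrc : r ∈ closure (range ev) := (hAB ▸ Or.inl hr : r ∈ corona (0 : ℝ≥0)).1
    have hcl : IsClosed {r : Cube | (r ⟨g, hg⟩ : ℝ) = 0 ∨ (r ⟨g, hg⟩ : ℝ) = 1} :=
      (isClosed_eq (continuous_coord _) continuous_const).union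
        (isClosed_eq (continuous_coord _) continuous_const)
    refine closure_minimal ?_ hcl (hV.inter_closure ⟨hAV hr, hrc⟩)
    rintro _ ⟨hxV, x, rfl⟩
    have hxW := disjoint_left.1 hVW hxV
    by_cases h : Even (N x)
    · exact Or.inl (hg0 x ⟨hxW, h⟩)
    · exact Or.inr (hg1 x ⟨hxW, h⟩)
  have hat : Tendsto (fun n => φ (b n)) atTop atTop :=
    tendsto_atTop_mono (fun n => (hbn n).trans (hba n).le) tendsto_natCast_atTop_atTop
  have hval : ∀ σ : ℕ → ℕ, StrictMono σ → ∀ c : ℝ, (∀ n, g (φ (b (σ n))) = c) →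
      ∃ r ∈ A, (r ⟨g, hg⟩ : ℝ) = c := by
    intro σ hσ c hc
    obtain ⟨r, hr, hrC⟩ := exists_mem_corona_of_tendsto (hat.comp hσ.tendsto_atTop)
    have hrP : r ∈ P := hrC P hPc (Eventually.of_forall fun n => (hφP _).2)
    refine ⟨r, ((hAB ▸ hr : r ∈ A ∪ B)).resolve_right (hPB hrP), ?_⟩
    exact hrC {q | (q ⟨g, hg⟩ : ℝ) = c} (isClosed_eq (continuous_coord _) continuous_const)
      (Eventually.of_forall hc)
  obtain ⟨r, hrA, hr⟩ := hval (fun n => 2 * n + 1) (fun _ _ h => by dsimp only; omega) 0 fun n =>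
    hg0 _ ⟨hφW _, by rw [hN]; exact ⟨n + 1, by ring⟩⟩
  obtain ⟨r', hrA', hr'⟩ := hval (fun n => 2 * n) (fun _ _ h => by dsimp only; omega) 1 fun n =>
    hg1 _ ⟨hφW _, by rw [hN]; simp⟩
  obtain ⟨s, hs, hs2⟩ := hconn.intermediate_value hrA hrA' (continuous_coord ⟨g, hg⟩).continuousOn
    (show (1 / 2 : ℝ) ∈ Icc _ _ by rw [hr, hr']; norm_num)
  rcases h01 s hs with h | h <;> norm_num [h] at hs2

theorem not_isDecomposable_corona : ¬ IsDecomposable (corona (0 : ℝ≥0)) := by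
  rintro ⟨A, B, ⟨-, hAc, hAconn, -⟩, ⟨-, hBc, -, -⟩, hA, hB, hAB⟩
  obtain ⟨⟨q, hq⟩, hqA⟩ := (ne_univ_iff_exists_notMem _).1 hA
  obtain ⟨⟨p, hp⟩, hpB⟩ := (ne_univ_iff_exists_notMem _).1 hB
  have hAk := (isCompact_iff_compactSpace.2 hAc).image continuous_subtype_val
  have hBk := (isCompact_iff_compactSpace.2 hBc).image continuous_subtype_val
  refine not_isPreconnected_of_union_eq hAk.isClosed hBk.isClosed ?_ hp ?_ hq ?_
    ((isConnected_iff_connectedSpace.2 hAconn).isPreconnected.image _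
      continuous_subtype_val.continuousOn)
  · rw [← image_union, hAB, image_univ, Subtype.range_coe]
  · rintro ⟨⟨_, _⟩, h, rfl⟩; exact hpB h
  · rintro ⟨⟨_, _⟩, h, rfl⟩; exact hqA h

end SubpowerHigson

/-- Here `ℝ≥0` is the half-line `[0, ∞)` with the usual metric, and its base point is `0`. -/
theorem theorem3p3 :
    SubpowerHigson.IsContinuum (SubpowerHigson.corona (0 : ℝ≥0)) ∧
      ¬ TopologicalSpace.MetrizableSpace (SubpowerHigson.corona (0 : ℝ≥0)) ∧
      ¬ SubpowerHigson.IsDecomposable (SubpowerHigson.corona (0 : ℝ≥0)) :=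
  ⟨SubpowerHigson.isContinuum_corona, SubpowerHigson.not_metrizableSpace_corona,
    SubpowerHigson.not_isDecomposable_corona⟩
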